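/- Let $(s_k)_{k\ge 1}$ be a sequence of positive integers. Define binary words by $\alpha_1=01$ and $\alpha_{i+1}=(\alpha_i)^{s_i}(\overline{\alpha}_i)^{s_i}$, where $\overline{\alpha}$ is obtained from $\alpha$ by exchanging $0$ and $1$, and let $\mathcal{L}^{(s_k)}$ be the set of all factors (consecutive subwords) of the words $\alpha_i$, $i\ge 1$. Let $\rho$ be the substitution $0\mapsto \mathsf{d}\,\mathsf{r_d}$, $1\mapsto \mathsf{u}\,\mathsf{r_u}$ into words over $\{\mathsf{u},\mathsf{d},\mathsf{r_u},\mathsf{r_d}\}$, and let $\mathcal{P}^{(s_k)}$ be the set of all factors of words $\rho(w)$ with $w\in\mathcal{L}^{(s_k)}$. For $w=w(1)\cdots w(n)\in\mathcal{P}^{(s_k)}$, choose points $p_0,p_1,\dots,p_n$ in the plane as follows. The point $p_0$ (the origin) is arbitrary. The pin $p_1$ lies to the right of $p_0$, above it if $w(1)\in\{\mathsf{u},\mathsf{r_u}\}$ and below it if $w(1)\in\{\mathsf{d},\mathsf{r_d}\}$. For $i\ge 1$, the pin $p_{i+1}$ lies outside the rectangular hull (smallest enclosing axis-parallel rectangle)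 of $\{p_0,\dots,p_i\}$, beyond it upwards, downwards or to the right according as $w(i+1)$ is $\mathsf{u}$, is $\mathsf{d}$, or belongs to $\{\mathsf{r_u},\mathsf{r_d}\}$, and it separates $p_i$ from $\{p_0,\dots,p_{i-1}\}$, meaning that it lies horizontally or vertically strictly between $p_i$ and the rectangular hull of $\{p_0,\dots,p_{i-1}\}$. Let $\psi^\circ_w$ be the permutation of length $n$ whose plot is order isomorphic to $\{p_1,\dots,p_n\}$ (the origin is left out). Let $\mathcal{C}^{(s_k)}$ be the class of all permutations contained (as patterns) in $\psi^\circ_w$ for some $w\in\mathcal{P}^{(s_k)}$, and let $\mathcal{C}^{(s_k)}_n$ be the set of its members of length $n$. Then, for every sequence $(s_k)$ of positive integers, $\mathcal{C}^{(s_k)}$ has a proper growth rate: the limit $\lim_{n\to\infty}\sqrt[n]{|\mathcal{C}^{(s_k)}_n|}$ exists as a finite real number. -/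

import Mathlib

open Filter Topology

namespace PinClass

/-! ### Permutations, containment, growth rates -/

/-- A permutation `π` of length `n` contains a permutation `σ` of length `m` if some subsequence of
`π` of length `m` has the same pairwise comparisons as `σ`. -/
def Contains {m n : ℕ} (π : Equiv.Perm (Fin n)) (σ : Equiv.Perm (Fin m)) : Prop :=
  ∃ f : Fin m ↪o Fin n, ∀ i j : Fin m, σ i < σ j ↔ π (f i) < π (f j)

/-- The downward closure of a set of permutations (given length by length) under containment. -/
def downwardClosure (X : ∀ n : ℕ, Set (Equiv.Perm (Fin n))) (m : ℕ) : Set (Equiv.Perm (Fin m)) :=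
  {σ | ∃ n : ℕ, ∃ π ∈ X n, Contains π σ}

/-- A class `C` (with `C n` its set of members of length `n`) has a proper growth rate if the limit
of the `n`-th roots of its counting sequence exists, as a (finite) real number. -/
def HasProperGrowthRate (C : ∀ n : ℕ, Set (Equiv.Perm (Fin n))) : Prop :=
  ∃ g : ℝ, Tendsto (fun n : ℕ => ((C n).ncard : ℝ) ^ (1 / (n : ℝ))) atTop (𝓝 g)

/-! ### The binary words and languages -/

/-- The words `α₁, α₂, …`; the letters `0` and `1` are `false` and `true`. Both the sequence `s`
and the words are indexed from `0` here: `alpha s i` is `α_{i+1}` and `s i` is `s_{i+1}`. -/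
def alpha (s : ℕ → ℕ) : ℕ → List Bool
  | 0 => [false, true]
  | i + 1 =>
    (List.replicate (s i) (alpha s i)).flatten ++
      (List.replicate (s i) ((alpha s i).map not)).flatten

/-- The language of all factors of the words `α_i`. -/
def binaryLanguage (s : ℕ → ℕ) : Set (List Bool) :=
  {w | ∃ i : ℕ, w <:+: alpha s i}

/-! ### Rightward-yearning pin sequences -/

/-- The alphabet `{u, d, r_u, r_d}`. -/
inductive PinLetter
  | u
  | d
  | ru
  | rd

/-- The substitution `0 ↦ d r_d`, `1 ↦ u r_u`. -/
def rho (w : List Bool) : List PinLetter :=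
  w.flatMap fun b => if b then [PinLetter.u, PinLetter.ru] else [PinLetter.d, PinLetter.rd]

/-- The factor closure of the image under `rho` of the language of `s`. -/
def pinLanguage (s : ℕ → ℕ) : Set (List PinLetter) :=
  {v | ∃ w ∈ binaryLanguage s, v <:+: rho w}

/-- The placement of the first pin `p` relative to the origin `o`: always to the right; above for
`u` and `r_u`, below for `d` and `r_d`. -/
def IsFirstPin (o p : ℝ × ℝ) : PinLetter → Prop
  | .u | .ru => o.1 < p.1 ∧ o.2 < p.2
  | .d | .rd => o.1 < p.1 ∧ p.2 < o.2

/-- `p` lies beyond the rectangular hull of `S` in the direction (up, down or right) of the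
letter; the subscript of a right pin does not affect its direction. -/
def LiesInDirection (p : ℝ × ℝ) (S : Set (ℝ × ℝ)) : PinLetter → Prop
  | .u => ∀ q ∈ S, q.2 < p.2
  | .d => ∀ q ∈ S, p.2 < q.2
  | .ru | .rd => ∀ q ∈ S, q.1 < p.1

/-- `p` separates `q` from `S`: it lies horizontally or vertically (strictly) between `q` and the
rectangular hull of `S`. -/
def Separates (p q : ℝ × ℝ) (S : Set (ℝ × ℝ)) : Prop :=
  ((∀ r ∈ S, r.1 < p.1) ∧ p.1 < q.1) ∨ (q.1 < p.1 ∧ ∀ r ∈ S, p.1 < r.1) ∨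
  ((∀ r ∈ S, r.2 < p.2) ∧ p.2 < q.2) ∨ (q.2 < p.2 ∧ ∀ r ∈ S, p.2 < r.2)

/-- The points `p 0, p 1, …, p n` form a rightward-yearning pin sequence, with origin `p 0`, for
the word `w` of length `n`: the first pin is placed relative to the origin, and each later pin
`p (i + 2)` (whose letter is the one at the 0-based position `i + 1` of `w`) is a proper pin for
`p 0, …, p (i + 1)` in the direction of its letter: it lies outside the rectangular hull of these
points, in that direction, and separates `p (i + 1)` from `p 0, …, p i`. -/
structure IsPinSequence (w : List PinLetter) (p : ℕ → ℝ × ℝ) : Prop where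
  first : ∀ h : 0 < w.length, IsFirstPin (p 0) (p 1) w[0]
  direction : ∀ (i : ℕ) (h : i + 1 < w.length),
    LiesInDirection (p (i + 2)) {q | ∃ j ≤ i + 1, q = p j} w[i + 1]
  separates : ∀ (i : ℕ), i + 1 < w.length →
    Separates (p (i + 2)) (p (i + 1)) {q | ∃ j ≤ i, q = p j}

/-- `π` is the permutation `ψ°_w`: its plot is order isomorphic to the set of pins `p 1, …, p n`
of a pin sequence for `w`, the origin `p 0` being left out. The bijection `e` matches the `k`-th
entry of `π` with the pin `p (e k + 1)`. -/
def IsPinPerm (w : List PinLetter) {n : ℕ} (π : Equiv.Perm (Fin n)) : Prop :=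
  n = w.length ∧ ∃ p : ℕ → ℝ × ℝ, IsPinSequence w p ∧
    ∃ e : Equiv.Perm (Fin n),
      (∀ k l : Fin n, k < l ↔ (p (e k + 1)).1 < (p (e l + 1)).1) ∧
      (∀ k l : Fin n, π k < π l ↔ (p (e k + 1)).2 < (p (e l + 1)).2)

/-- The class `C^{(s_k)}`: the downward closure of the permutations `ψ°_w`, for `w` in the pin
language of `s`. `pinClass s n` is its set of members of length `n`. -/
def pinClass (s : ℕ → ℕ) : ∀ n : ℕ, Set (Equiv.Perm (Fin n)) :=
  downwardClosure fun _ => {π | ∃ w ∈ pinLanguage s, IsPinPerm w π}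

end PinClass

/-! The growth rate comes from Fekete's lemma, applied to patterns that also record which points lie
above the origin.

Geometry: in the pin language the order of the pins depends only on the word
(`IsPinSequence.lt_iff`), so explicit integer coordinates replace all pin sequences
(`mem_pinClass_iff`). Translating positions preserves vertical comparisons and sides of the origin.

Supermultiplicativity: `alpha s (i + 2)` begins and ends with `alpha s i`, so any two words of the
language occur one after the other in a third (`exists_append_mem_pinLanguage`). Points chosen from
the first then lie to the left of points chosen from the second, so any two centred patterns sit
side by side in a larger one (`card_centredPatterns_mul_le`).

Exponential bound: of two points far apart horizontally, the right one is farther from the origin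
vertically, so its side of the origin decides the comparison. Boundedly many bits per point remain
(`card_centredPatterns_le`).

Forgetting the origin merges at most `n + 1` centred patterns, a factor that vanishes under `n`-th
roots. -/

namespace PinClass

/-! ### Canonical coordinates of pins -/

/-- The canonical abscissa of a pin with letter `l` at the 0-based position `j`. -/
def abscissa : PinLetter → ℕ → ℤ
  -- A pin reaches `2 * j + 4` in its own direction. For a later pin, the separating coordinate `2 *
  -- j + 1` lies below its predecessor's reach `2 * j + 2` and above `2 * j`, which bounds all
  -- earlier points.
  | .u, j | .d, j => 2 * j + 1
  | .ru, j | .rd, j => 2 * j + 4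

/-- The canonical ordinate of a pin with letter `l` at the 0-based position `j`. -/
def ordinate : PinLetter → ℕ → ℤ
  | .u, j => 2 * j + 4
  | .d, j => -(2 * j + 4)
  | .ru, j => 2 * j + 1
  | .rd, j => -(2 * j + 1)

theorem abscissa_injective {l l' : PinLetter} {i j : ℕ} (h : abscissa l i = abscissa l' j) :
    i = j := by
  cases l <;> cases l' <;> simp only [abscissa] at h <;> omega

theorem ordinate_injective {l l' : PinLetter} {i j : ℕ} (h : ordinate l i = ordinate l' j) :
    i = j := by
  cases l <;> cases l' <;> simp only [ordinate] at h <;> omega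

theorem abscissa_add (l : PinLetter) (s j : ℕ) :
    abscissa l (s + j) = 2 * s + abscissa l j := by
  cases l <;> simp only [abscissa] <;> push_cast <;> ring

theorem ordinate_add_lt_iff (l l' : PinLetter) (s i j : ℕ) :
    ordinate l (s + i) < ordinate l' (s + j) ↔ ordinate l i < ordinate l' j := by
  cases l <;> cases l' <;> simp only [ordinate] <;> omega

theorem ordinate_add_pos_iff (l : PinLetter) (s j : ℕ) :
    0 < ordinate l (s + j) ↔ 0 < ordinate l j := by
  cases l <;> simp only [ordinate] <;> omega

/-- Consecutive positions have abscissae at most 5 apart, so a gap of 6 forces `i + 2 ≤ j`; then the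
later ordinate, at least `2 * j + 1` in absolute value, exceeds the earlier one, at most `2 * i +
4`. -/
theorem ordinate_lt_iff_of_abscissa {l l' : PinLetter} {i j : ℕ}
    (h : abscissa l i + 6 ≤ abscissa l' j) :
    ordinate l i < ordinate l' j ↔ 0 < ordinate l' j := by
  cases l <;> cases l' <;> simp only [abscissa, ordinate] at h ⊢ <;> omega

/-! ### Letters that may follow each other -/

/-- The letters that may follow each letter in the pin language. -/
def MayFollow : PinLetter → PinLetter → Prop
  | .u, .ru | .d, .rd | .ru, .u | .ru, .d | .rd, .u | .rd, .d => True
  | _, _ => False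

/-- The condition on the first letter carries the induction across the boundary between two blocks.
-/
theorem isChain_rho (w : List Bool) :
    (rho w).IsChain MayFollow ∧ ∀ l ∈ (rho w).head?, l = .u ∨ l = .d := by
  induction w with
  | nil => simp [rho]
  | cons b w ih =>
    obtain ⟨h, hd⟩ := ih
    have e : rho (b :: w) =
        (if b then [PinLetter.u, PinLetter.ru] else [PinLetter.d, PinLetter.rd]) ++ rho w := by
      simp [rho]
    rw [e]
    cases b <;>
    · simp only [Bool.false_eq_true, if_true, if_false, List.cons_append, List.nil_append,
        List.isChain_cons, List.head?_cons, Option.mem_some_iff]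
      refine ⟨⟨?_, ?_, h⟩, ?_⟩
      · rintro y rfl; trivial
      · intro y hy
        rcases hd y hy with rfl | rfl <;> trivial
      · rintro y rfl; simp

theorem mayFollow_of_mem {s : ℕ → ℕ} {w : List PinLetter} (hw : w ∈ pinLanguage s) (i : ℕ)
    (h : i + 1 < w.length) : MayFollow w[i] w[i + 1] := by
  obtain ⟨v, -, hv⟩ := hw
  exact List.isChain_iff_getElem.1 ((isChain_rho v).1.infix hv) i h

/-! ### The canonical pin sequence -/

/-- The canonical pin sequence for `w`. -/
noncomputable def canonicalPin (w : List PinLetter) : ℕ → ℝ × ℝ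
  | 0 => (0, 0)
  | j + 1 => ((abscissa (w.getD j .u) j : ℤ), (ordinate (w.getD j .u) j : ℤ))

theorem canonicalPin_succ {w : List PinLetter} {j : ℕ} (h : j < w.length) :
    canonicalPin w (j + 1) = (((abscissa w[j] j : ℤ) : ℝ), ((ordinate w[j] j : ℤ) : ℝ)) := by
  simp [canonicalPin, h]

theorem abscissa_mem_Icc (l : PinLetter) (j : ℕ) :
    2 * (j : ℤ) + 1 ≤ abscissa l j ∧ abscissa l j ≤ 2 * j + 4 := by
  cases l <;> simp only [abscissa] <;> omega

theorem abs_ordinate_le (l : PinLetter) (j : ℕ) :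
    -(2 * (j : ℤ) + 4) ≤ ordinate l j ∧ ordinate l j ≤ 2 * j + 4 := by
  cases l <;> simp only [ordinate] <;> omega

theorem isPinSequence_canonicalPin {w : List PinLetter}
    (hw : ∀ (i : ℕ) (h : i + 1 < w.length), MayFollow w[i] w[i + 1]) :
    IsPinSequence w (canonicalPin w) where
  first h := by
    rw [canonicalPin_succ h]
    generalize w[0] = l
    cases l <;> simp [IsFirstPin, canonicalPin, abscissa, ordinate]
  direction i h := by
    have hm := hw i h
    rw [canonicalPin_succ h]
    -- Only the last pin needs exact coordinates; the origin and the other pins enter through a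
    -- bounding box.
    have key : ∀ q ∈ {q | ∃ j ≤ i + 1, q = canonicalPin w j},
        ∃ x y : ℤ, q = ((x : ℝ), (y : ℝ)) ∧ ((x = abscissa w[i] i ∧ y = ordinate w[i] i) ∨
          (x ≤ 2 * i + 2 ∧ -(2 * i + 2) ≤ y ∧ y ≤ 2 * i + 2)) := by
      rintro q ⟨j, hj, rfl⟩
      cases j with
      | zero => exact ⟨0, 0, by simp [canonicalPin], by right; omega⟩
      | succ j =>
        refine ⟨_, _, canonicalPin_succ (by omega), ?_⟩
        rcases Nat.lt_or_ge j i with h1 | h1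
        · have := abscissa_mem_Icc w[j] j
          have := abs_ordinate_le w[j] j
          right; omega
        · obtain rfl : j = i := by omega
          left; simp
    generalize w[i] = l at *
    generalize w[i + 1] = l' at *
    cases l <;> cases l' <;> simp only [MayFollow] at hm <;> intro q hq <;>
      obtain ⟨x, y, rfl, hxy⟩ := key q hq <;> simp only [abscissa, ordinate, Int.cast_lt] at hxy ⊢ <;>
      omega
  separates i h := by
    have hm := hw i h
    rw [canonicalPin_succ h, canonicalPin_succ (by omega : i < w.length)]
    have key : ∀ q ∈ {q | ∃ j ≤ i, q = canonicalPin w j},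
        ∃ x y : ℤ, q = ((x : ℝ), (y : ℝ)) ∧
          (x ≤ 2 * i + 2 ∧ -(2 * i + 2) ≤ y ∧ y ≤ 2 * i + 2) := by
      rintro q ⟨j, hj, rfl⟩
      cases j with
      | zero => exact ⟨0, 0, by simp [canonicalPin], by omega⟩
      | succ j =>
        refine ⟨_, _, canonicalPin_succ (by omega), ?_⟩
        have := abscissa_mem_Icc w[j] j
        have := abs_ordinate_le w[j] j
        omega
    generalize w[i] = l at *
    generalize w[i + 1] = l' at *
    cases l <;> cases l' <;> simp only [MayFollow] at hm
    case u.ru =>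
      refine Or.inr (Or.inr (Or.inl ⟨fun q hq => ?_, ?_⟩))
      · obtain ⟨x, y, rfl, hxy⟩ := key q hq
        simp only [ordinate, Int.cast_lt]; omega
      · simp only [ordinate, Int.cast_lt]; omega
    case d.rd =>
      refine Or.inr (Or.inr (Or.inr ⟨?_, fun q hq => ?_⟩))
      · simp only [ordinate, Int.cast_lt]; omega
      · obtain ⟨x, y, rfl, hxy⟩ := key q hq
        simp only [ordinate, Int.cast_lt]; omega
    all_goals
      refine Or.inl ⟨fun q hq => ?_, ?_⟩
      · obtain ⟨x, y, rfl, hxy⟩ := key q hq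
        simp only [abscissa, Int.cast_lt]; omega
      · simp only [abscissa, Int.cast_lt]; omega

/-! ### All pin sequences for a word are order isomorphic -/

/-- A vertical pin separates its predecessor horizontally from all earlier points. -/
theorem IsPinSequence.vertical {w : List PinLetter} {p : ℕ → ℝ × ℝ} (hp : IsPinSequence w p)
    {j : ℕ} (h : j + 1 < w.length) (hl : w[j + 1] = .u ∨ w[j + 1] = .d)
    (hx : (p 0).1 < (p (j + 1)).1) :
    (∀ i ≤ j, (p i).1 < (p (j + 2)).1) ∧ (p (j + 2)).1 < (p (j + 1)).1 := by
  have hD := hp.direction j h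
  have m0 : p 0 ∈ {q | ∃ i ≤ j, q = p i} := ⟨0, by omega, rfl⟩
  have n0 : p 0 ∈ {q | ∃ i ≤ j + 1, q = p i} := ⟨0, by omega, rfl⟩
  have nj : p (j + 1) ∈ {q | ∃ i ≤ j + 1, q = p i} := ⟨j + 1, by omega, rfl⟩
  rcases hp.separates j h with ⟨a, b⟩ | ⟨b, a⟩ | ⟨a, b⟩ | ⟨b, a⟩
  · exact ⟨fun i hi => a _ ⟨i, hi, rfl⟩, b⟩
  · have := a _ m0
    linarith
  -- Vertical separation would put the new pin between the heights of the origin and its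
  -- predecessor, against its direction.
  all_goals
    have := a _ m0
    rcases hl with e | e <;> rw [e] at hD <;> have := hD _ n0 <;> have := hD _ nj <;> linarith

/-- An upper right pin separates its predecessor vertically from all earlier points. -/
theorem IsPinSequence.right_up {w : List PinLetter} {p : ℕ → ℝ × ℝ} (hp : IsPinSequence w p)
    {j : ℕ} (h : j + 1 < w.length) (hl : w[j + 1] = .ru) (hy : (p 0).2 < (p (j + 1)).2) :
    (∀ i ≤ j, (p i).2 < (p (j + 2)).2) ∧ (p (j + 2)).2 < (p (j + 1)).2 := by
  have hD := hp.direction j h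
  have m0 : p 0 ∈ {q | ∃ i ≤ j, q = p i} := ⟨0, by omega, rfl⟩
  have n0 := (hl ▸ hD) (p 0) ⟨0, by omega, rfl⟩
  have nj := (hl ▸ hD) (p (j + 1)) ⟨j + 1, by omega, rfl⟩
  rcases hp.separates j h with ⟨a, b⟩ | ⟨b, a⟩ | ⟨a, b⟩ | ⟨b, a⟩ <;> have := a _ m0
  · linarith
  · linarith
  · exact ⟨fun i hi => a _ ⟨i, hi, rfl⟩, b⟩
  · linarith

/-- A lower right pin separates its predecessor vertically from all earlier points. -/
theorem IsPinSequence.right_down {w : List PinLetter} {p : ℕ → ℝ × ℝ} (hp : IsPinSequence w p)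
    {j : ℕ} (h : j + 1 < w.length) (hl : w[j + 1] = .rd) (hy : (p (j + 1)).2 < (p 0).2) :
    (∀ i ≤ j, (p (j + 2)).2 < (p i).2) ∧ (p (j + 1)).2 < (p (j + 2)).2 := by
  have hD := hp.direction j h
  have m0 : p 0 ∈ {q | ∃ i ≤ j, q = p i} := ⟨0, by omega, rfl⟩
  have n0 := (hl ▸ hD) (p 0) ⟨0, by omega, rfl⟩
  have nj := (hl ▸ hD) (p (j + 1)) ⟨j + 1, by omega, rfl⟩
  rcases hp.separates j h with ⟨a, b⟩ | ⟨b, a⟩ | ⟨a, b⟩ | ⟨b, a⟩ <;> have := a _ m0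
  · linarith
  · linarith
  · linarith
  · exact ⟨fun i hi => a _ ⟨i, hi, rfl⟩, b⟩

/-- The position of a pin with respect to the origin and to the earlier pins. -/
theorem IsPinSequence.relativePosition {w : List PinLetter} {p : ℕ → ℝ × ℝ}
    (hw : ∀ (i : ℕ) (h : i + 1 < w.length), MayFollow w[i] w[i + 1]) (hp : IsPinSequence w p)
    (j : ℕ) (h : j < w.length) :
    (p 0).1 < (p (j + 1)).1 ∧
    (0 < ordinate w[j] j → (p 0).2 < (p (j + 1)).2) ∧
    (ordinate w[j] j < 0 → (p (j + 1)).2 < (p 0).2) ∧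
    ∀ i (hij : i < j),
      ((abscissa w[i] i < abscissa w[j] j ∧ (p (i + 1)).1 < (p (j + 1)).1) ∨
        (abscissa w[j] j < abscissa w[i] i ∧ (p (j + 1)).1 < (p (i + 1)).1)) ∧
      ((ordinate w[i] i < ordinate w[j] j ∧ (p (i + 1)).2 < (p (j + 1)).2) ∨
        (ordinate w[j] j < ordinate w[i] i ∧ (p (j + 1)).2 < (p (i + 1)).2)) := by
  induction j with
  | zero =>
    have := hp.first h
    generalize w[0] = l at *
    refine ⟨?_, ?_, ?_, by simp⟩ <;> revert this <;>
      cases l <;> simp +contextual [IsFirstPin, ordinate]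
  | succ j ih =>
    obtain ⟨hx, hu, hd, -⟩ := ih (by omega)
    have hm := hw j h
    have hD := hp.direction j h
    have hV := fun hl => hp.vertical h hl hx
    have hU := hp.right_up h
    have hL := hp.right_down h
    have mem : ∀ i ≤ j + 1, p i ∈ {q | ∃ i ≤ j + 1, q = p i} := fun i hi => ⟨i, hi, rfl⟩
    have hb : ∀ i (hij : i < j), abscissa w[i] i ≤ 2 * j + 2 ∧
        -(2 * j + 2) ≤ ordinate w[i] i ∧ ordinate w[i] i ≤ 2 * j + 2 := by
      intro i hij
      have := abscissa_mem_Icc w[i] i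
      have := abs_ordinate_le w[i] i
      omega
    -- The immediate predecessor is treated apart: the new pin cuts it off from all earlier points,
    -- so in the separating coordinate it compares the other way.
    have split : ∀ P : ∀ i, i < j + 1 → Prop, (∀ i (hi : i < j), P i (by omega)) →
        P j (by omega) → ∀ i hi, P i hi := by
      intro P h1 h2 i hi
      rcases Nat.lt_succ_iff_lt_or_eq.1 hi with h3 | rfl
      exacts [h1 i h3, h2]
    refine ⟨?_, ?_, ?_, split _ (fun i hi => ?_) ?_⟩
    case refine_4 =>
      have hb := hb i hi
      generalize abscissa w[i] i = x at *
      generalize ordinate w[i] i = y at *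
      generalize w[j] = l at *
      generalize w[j + 1] = l' at *
      cases l' <;> cases l <;> simp only [MayFollow] at hm
      case u.ru | u.rd =>
        exact ⟨.inl ⟨by simp only [abscissa]; omega, (hV (.inl rfl)).1 _ (by omega)⟩,
          .inl ⟨by simp only [ordinate]; omega, hD _ (mem (i + 1) (by omega))⟩⟩
      case d.ru | d.rd =>
        exact ⟨.inl ⟨by simp only [abscissa]; omega, (hV (.inr rfl)).1 _ (by omega)⟩,
          .inr ⟨by simp only [ordinate]; omega, hD _ (mem (i + 1) (by omega))⟩⟩
      case ru.u =>
        exact ⟨.inl ⟨by simp only [abscissa]; omega, hD _ (mem (i + 1) (by omega))⟩,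
          .inl ⟨by simp only [ordinate]; omega,
            (hU rfl (hu (by simp only [ordinate]; omega))).1 _ (by omega)⟩⟩
      case rd.d =>
        exact ⟨.inl ⟨by simp only [abscissa]; omega, hD _ (mem (i + 1) (by omega))⟩,
          .inr ⟨by simp only [ordinate]; omega,
            (hL rfl (hd (by simp only [ordinate]; omega))).1 _ (by omega)⟩⟩
    all_goals
      clear hb
      generalize w[j] = l at *
      generalize w[j + 1] = l' at *
      cases l' <;> cases l <;> simp only [MayFollow] at hm
    case refine_1.u.ru | refine_1.u.rd => exact (hV (.inl rfl)).1 _ (by omega)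
    case refine_1.d.ru | refine_1.d.rd => exact (hV (.inr rfl)).1 _ (by omega)
    case refine_1.ru.u | refine_1.rd.d => exact hD _ (mem 0 (by omega))
    case refine_2.u.ru | refine_2.u.rd => exact fun _ => hD _ (mem 0 (by omega))
    case refine_2.ru.u =>
      exact fun _ => (hU rfl (hu (by simp only [ordinate]; omega))).1 _ (by omega)
    case refine_2.d.ru | refine_2.d.rd | refine_2.rd.d =>
      intro h0; simp only [ordinate] at h0; omega
    case refine_3.d.ru | refine_3.d.rd => exact fun _ => hD _ (mem 0 (by omega))
    case refine_3.rd.d =>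
      exact fun _ => (hL rfl (hd (by simp only [ordinate]; omega))).1 _ (by omega)
    case refine_3.u.ru | refine_3.u.rd | refine_3.ru.u =>
      intro h0; simp only [ordinate] at h0; omega
    case refine_5.u.ru | refine_5.u.rd =>
      exact ⟨.inr ⟨by simp only [abscissa]; omega, (hV (.inl rfl)).2⟩,
        .inl ⟨by simp only [ordinate]; omega, hD _ (mem (j + 1) (by omega))⟩⟩
    case refine_5.d.ru | refine_5.d.rd =>
      exact ⟨.inr ⟨by simp only [abscissa]; omega, (hV (.inr rfl)).2⟩,
        .inr ⟨by simp only [ordinate]; omega, hD _ (mem (j + 1) (by omega))⟩⟩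
    case refine_5.ru.u =>
      exact ⟨.inl ⟨by simp only [abscissa]; omega, hD _ (mem (j + 1) (by omega))⟩,
        .inr ⟨by simp only [ordinate]; omega, (hU rfl (hu (by simp only [ordinate]; omega))).2⟩⟩
    case refine_5.rd.d =>
      exact ⟨.inl ⟨by simp only [abscissa]; omega, hD _ (mem (j + 1) (by omega))⟩,
        .inl ⟨by simp only [ordinate]; omega, (hL rfl (hd (by simp only [ordinate]; omega))).2⟩⟩

/-- The relative order of the pins depends only on the word. -/
theorem IsPinSequence.lt_iff {w : List PinLetter} {p : ℕ → ℝ × ℝ}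
    (hw : ∀ (i : ℕ) (h : i + 1 < w.length), MayFollow w[i] w[i + 1]) (hp : IsPinSequence w p)
    {i j : ℕ} (hi : i < w.length) (hj : j < w.length) :
    ((p (i + 1)).1 < (p (j + 1)).1 ↔ abscissa w[i] i < abscissa w[j] j) ∧
    ((p (i + 1)).2 < (p (j + 1)).2 ↔ ordinate w[i] i < ordinate w[j] j) := by
  have key : ∀ {a b : ℝ} {x y : ℤ}, (x < y ∧ a < b) ∨ (y < x ∧ b < a) →
      (a < b ↔ x < y) ∧ (b < a ↔ y < x) := by
    rintro a b x y (⟨h1, h2⟩ | ⟨h1, h2⟩)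
    · exact ⟨iff_of_true h2 h1, iff_of_false h2.not_gt h1.not_gt⟩
    · exact ⟨iff_of_false h2.not_gt h1.not_gt, iff_of_true h2 h1⟩
  rcases lt_trichotomy i j with h | rfl | h
  · obtain ⟨h1, h2⟩ := (hp.relativePosition hw j hj).2.2.2 i h
    exact ⟨(key h1).1, (key h2).1⟩
  · simp
  · obtain ⟨h1, h2⟩ := (hp.relativePosition hw i hi).2.2.2 j h
    exact ⟨(key h1).2, (key h2).2⟩

/-! ### Recurrence of the pin language -/

theorem rho_append (v w : List Bool) : rho (v ++ w) = rho v ++ rho w := by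
  simp [rho]

theorem alpha_succ {s : ℕ → ℕ} (hs : ∀ k, 0 < s k) (i : ℕ) :
    ∃ t, alpha s (i + 1) = alpha s i ++ t ++ (alpha s i).map not := by
  obtain ⟨k, hk⟩ := Nat.exists_eq_succ_of_ne_zero (hs i).ne'
  refine ⟨(List.replicate k (alpha s i)).flatten ++
    (List.replicate k ((alpha s i).map not)).flatten, ?_⟩
  rw [alpha, hk]
  nth_rw 1 [List.replicate_succ]
  rw [Nat.succ_eq_add_one, List.replicate_succ']
  simp

theorem alpha_ne_nil {s : ℕ → ℕ} (hs : ∀ k, 0 < s k) (i : ℕ) : alpha s i ≠ [] := by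
  induction i with
  | zero => simp [alpha]
  | succ i ih =>
    obtain ⟨t, ht⟩ := alpha_succ hs i
    simp [ht, ih]

theorem alpha_isInfix {s : ℕ → ℕ} (hs : ∀ k, 0 < s k) {i j : ℕ} (hij : i ≤ j) :
    alpha s i <:+: alpha s j := by
  induction j, hij using Nat.le_induction with
  | base => exact List.infix_rfl
  | succ j _ ih =>
    obtain ⟨t, ht⟩ := alpha_succ hs j
    exact ih.trans ⟨[], t ++ (alpha s j).map not, by simp [ht]⟩

/-- The complement of `alpha s (i + 1)` ends with the double complement of `alpha s i`. -/
theorem alpha_add_two {s : ℕ → ℕ} (hs : ∀ k, 0 < s k) (i : ℕ) :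
    ∃ t, t ≠ [] ∧ alpha s (i + 2) = alpha s i ++ t ++ alpha s i := by
  obtain ⟨t, ht⟩ := alpha_succ hs i
  obtain ⟨t', ht'⟩ := alpha_succ hs (i + 1)
  refine ⟨t ++ (alpha s i).map not ++ t' ++ (alpha s i).map not ++ t.map not, ?_, ?_⟩
  · simp [alpha_ne_nil hs]
  · rw [ht', ht]
    simp [Function.comp_def]

theorem rho_mono {v w : List Bool} (h : v <:+: w) : rho v <:+: rho w := by
  obtain ⟨a, b, rfl⟩ := h
  exact ⟨rho a, rho b, by simp [rho_append]⟩

theorem mem_pinLanguage_iff {s : ℕ → ℕ} {v : List PinLetter} :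
    v ∈ pinLanguage s ↔ ∃ i, v <:+: rho (alpha s i) := by
  constructor
  · rintro ⟨w, ⟨i, hi⟩, hv⟩
    exact ⟨i, hv.trans (rho_mono hi)⟩
  · rintro ⟨i, hi⟩
    exact ⟨_, ⟨i, List.infix_rfl⟩, hi⟩

/-- Any two words of the pin language occur in a common word of the language, with a gap. -/
theorem exists_append_mem_pinLanguage {s : ℕ → ℕ} (hs : ∀ k, 0 < s k) {v w : List PinLetter}
    (hv : v ∈ pinLanguage s) (hw : w ∈ pinLanguage s) :
    ∃ t, t ≠ [] ∧ v ++ t ++ w ∈ pinLanguage s := by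
  rw [mem_pinLanguage_iff] at hv hw
  obtain ⟨i, hi⟩ := hv
  obtain ⟨j, hj⟩ := hw
  obtain ⟨a, b, hab⟩ := hi.trans (rho_mono (alpha_isInfix hs (le_max_left i j)))
  obtain ⟨c, d, hcd⟩ := hj.trans (rho_mono (alpha_isInfix hs (le_max_right i j)))
  obtain ⟨t, ht, h⟩ := alpha_add_two hs (max i j)
  refine ⟨b ++ rho t ++ c, ?_, mem_pinLanguage_iff.2 ⟨max i j + 2, a, d, ?_⟩⟩
  · obtain ⟨x, t, rfl⟩ := List.exists_cons_of_ne_nil ht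
    cases x <;> simp [rho]
  · rw [h, rho_append, rho_append]
    nth_rw 1 [← hab]
    rw [← hcd]
    simp

/-! ### Centred patterns -/

/-- The centred patterns of length `n`: finitely many pins of a pin sequence, listed from left to
right, are recorded by their vertical comparisons and by the set of those above the origin. -/
def centredPatterns (s : ℕ → ℕ) (n : ℕ) : Set ((Fin n → Fin n → Prop) × (Fin n → Prop)) :=
  {P | ∃ w ∈ pinLanguage s, ∃ (g : Fin n → ℕ) (l : Fin n → PinLetter),
    (∀ k, w[g k]? = some (l k)) ∧ StrictMono (fun k => abscissa (l k) (g k)) ∧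
    P = (fun i j => ordinate (l i) (g i) < ordinate (l j) (g j),
      fun i => 0 < ordinate (l i) (g i))}

theorem ordinate_lt_iff_not_lt {w : List PinLetter} {n : ℕ} {g : Fin n → ℕ}
    {l : Fin n → PinLetter} (hl : ∀ k, w[g k]? = some (l k))
    (hg : StrictMono (fun k => abscissa (l k) (g k))) {a b : Fin n} (hab : a ≠ b) :
    ordinate (l b) (g b) < ordinate (l a) (g a) ↔
      ¬ ordinate (l a) (g a) < ordinate (l b) (g b) := by
  have : ordinate (l a) (g a) ≠ ordinate (l b) (g b) := by
    intro h
    have h1 := ordinate_injective h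
    have h2 : l a = l b := Option.some.inj (by rw [← hl a, ← hl b, h1])
    exact hab (hg.injective (by simp only [h1, h2]))
  omega

/-- Restriction to the first `m` and the last `n` points covers every pair of patterns. -/
theorem card_centredPatterns_mul_le {s : ℕ → ℕ} (hs : ∀ k, 0 < s k) (m n : ℕ) :
    (centredPatterns s m).ncard * (centredPatterns s n).ncard ≤
      (centredPatterns s (m + n)).ncard := by
  rw [← Set.ncard_prod]
  let f : (Fin (m + n) → Fin (m + n) → Prop) × (Fin (m + n) → Prop) →
      ((Fin m → Fin m → Prop) × (Fin m → Prop)) × ((Fin n → Fin n → Prop) × (Fin n → Prop)) :=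
    fun P => ((fun i j => P.1 (Fin.castAdd n i) (Fin.castAdd n j), fun i => P.2 (Fin.castAdd n i)),
      (fun i j => P.1 (Fin.natAdd m i) (Fin.natAdd m j), fun i => P.2 (Fin.natAdd m i)))
  refine (Set.ncard_le_ncard ?_ (Set.toFinite _)).trans
    (Set.ncard_image_le (f := f) (Set.toFinite (centredPatterns s (m + n))))
  rintro ⟨_, _⟩ ⟨⟨v, hv, g, l, hl, hg, rfl⟩, ⟨w, hw, g', l', hl', hg', rfl⟩⟩
  obtain ⟨t, ht, hvw⟩ := exists_append_mem_pinLanguage hs hv hw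
  have ht : 0 < t.length := List.length_pos_iff.2 ht
  refine ⟨_, ⟨v ++ t ++ w, hvw, Fin.append g (fun k => (v ++ t).length + g' k), Fin.append l l',
    ?_, ?_, rfl⟩, ?_⟩
  · intro k
    induction k using Fin.addCases with
    | left k =>
      have := (List.getElem?_eq_some_iff.1 (hl k)).1
      simp only [Fin.append_left]
      rw [List.append_assoc, List.getElem?_append_left this, hl]
    | right k =>
      simp only [Fin.append_right]
      rw [List.getElem?_append_right (by omega), Nat.add_sub_cancel_left, hl']
  · intro a b hab
    induction a using Fin.addCases with
    | left a =>
      induction b using Fin.addCases with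
      | left b =>
        simp only [Fin.append_left]
        exact hg (by rw [Fin.lt_def] at hab ⊢; simpa using hab)
      | right b =>
        simp only [Fin.append_left, Fin.append_right]
        -- Pins from `v` have abscissa at most `2 * v.length + 2`; as `t` is nonempty, those from
        -- `w` have at least `2 * v.length + 3`.
        have h1 := (List.getElem?_eq_some_iff.1 (hl a)).1
        have h2 := abscissa_mem_Icc (l a) (g a)
        have h3 := abscissa_mem_Icc (l' b) ((v ++ t).length + g' b)
        rw [List.length_append] at h3 ⊢
        omega
    | right a =>
      induction b using Fin.addCases with
      | left b =>
        simp only [Fin.lt_def, Fin.val_natAdd, Fin.val_castAdd] at hab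
        omega
      | right b =>
        simp only [Fin.append_right, abscissa_add, add_lt_add_iff_left]
        exact hg' (by rw [Fin.lt_def] at hab ⊢; simpa using hab)
  · simp only [f, Fin.append_left, Fin.append_right, ordinate_add_lt_iff, ordinate_add_pos_iff]

theorem add_le_of_strictMono {n : ℕ} {f : Fin n → ℤ} (hf : StrictMono f) {a b : Fin n}
    {d : ℕ} (h : (a : ℕ) + d ≤ b) : f a + d ≤ f b := by
  induction d generalizing b with
  | zero => simpa using hf.monotone (by rw [Fin.le_def]; omega)
  | succ d ih =>
    have h1 := ih (b := ⟨b - 1, by omega⟩) (by simp only; omega)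
    have h2 : f ⟨b - 1, by omega⟩ < f b := hf (by rw [Fin.lt_def]; simp only; omega)
    push_cast
    omega

/-- Each point is encoded by six bits: its side of the origin and its comparisons with the next five
points. Points six or more places apart have abscissae at least 6 apart, so the side of the right
one settles the comparison. -/
theorem card_centredPatterns_le (s : ℕ → ℕ) (n : ℕ) : (centredPatterns s n).ncard ≤ 64 ^ n := by
  let F : (Fin n → Fin n → Prop) × (Fin n → Prop) → Fin n → Prop × (Fin 5 → Prop) :=
    fun P a => (P.2 a, fun d => ∃ h : (a : ℕ) + d + 1 < n, P.1 a ⟨a + d + 1, h⟩)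
  have hF : Set.InjOn F (centredPatterns s n) := by
    rintro _ ⟨v, -, g, l, hl, hg, rfl⟩ _ ⟨w, -, g', l', hl', hg', rfl⟩ h
    have h2 : ∀ a, 0 < ordinate (l a) (g a) ↔ 0 < ordinate (l' a) (g' a) := fun a =>
      iff_of_eq (congrArg Prod.fst (congrFun h a))
    have h1 : ∀ a b : Fin n, a < b → (ordinate (l a) (g a) < ordinate (l b) (g b) ↔
        ordinate (l' a) (g' a) < ordinate (l' b) (g' b)) := by
      intro a b hab
      rcases Nat.lt_or_ge b (a + 6) with hb | hb
      · have := iff_of_eq (congrFun (congrArg Prod.snd (congrFun h a))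
          ⟨b - a - 1, by omega⟩)
        have e : (a : ℕ) + (b - a - 1) + 1 = b := by rw [Fin.lt_def] at hab; omega
        simpa [F, e] using this
      · rw [ordinate_lt_iff_of_abscissa (add_le_of_strictMono hg hb),
          ordinate_lt_iff_of_abscissa (add_le_of_strictMono hg' hb), h2]
    refine Prod.ext (funext fun a => funext fun b => propext ?_) (funext fun a => propext (h2 a))
    rcases lt_trichotomy a b with hab | rfl | hab
    · exact h1 a b hab
    · simp
    · exact (ordinate_lt_iff_not_lt hl hg hab.ne).trans
        ((not_congr (h1 b a hab)).trans (ordinate_lt_iff_not_lt hl' hg' hab.ne).symm)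
  calc (centredPatterns s n).ncard ≤ (Set.univ : Set (Fin n → Prop × (Fin 5 → Prop))).ncard :=
        Set.ncard_le_ncard_of_injOn F (fun _ _ => Set.mem_univ _) hF
    _ = 64 ^ n := by
        simp [Set.ncard_univ, Nat.card_eq_fintype_card]

/-! ### Comparison of the class with the centred patterns -/

theorem exists_perm_strictMono {n : ℕ} {f : Fin n → ℤ} (hf : Function.Injective f) :
    ∃ e : Equiv.Perm (Fin n), StrictMono (f ∘ e) :=
  ⟨Tuple.sort f, (Tuple.monotone_sort f).strictMono_of_injective
    (hf.comp (Tuple.sort f).injective)⟩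

/-- A permutation belongs to the class if and only if it is the order pattern of some pins of the
canonical pin sequence of a word. -/
theorem mem_pinClass_iff {s : ℕ → ℕ} {m : ℕ} {σ : Equiv.Perm (Fin m)} :
    σ ∈ pinClass s m ↔ ∃ w ∈ pinLanguage s, ∃ (g : Fin m → ℕ) (l : Fin m → PinLetter),
      (∀ k, w[g k]? = some (l k)) ∧ StrictMono (fun k => abscissa (l k) (g k)) ∧
      ∀ i j, σ i < σ j ↔ ordinate (l i) (g i) < ordinate (l j) (g j) := by
  constructor
  · rintro ⟨_, π, ⟨w, hw, rfl, p, hp, e, hx, hy⟩, f, hf⟩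
    have hlt := fun i j : Fin w.length => hp.lt_iff (mayFollow_of_mem hw) i.2 j.2
    refine ⟨w, hw, fun k => e (f k), fun k => w[e (f k)], fun k => by simp, ?_, fun i j => ?_⟩
    · intro i j hij
      exact (hlt _ _).1.1 ((hx _ _).1 (f.strictMono hij))
    · rw [hf, hy]
      exact (hlt _ _).2
  · rintro ⟨w, hw, g, l, hl, hg, hσ⟩
    have hm := mayFollow_of_mem hw
    have hp := isPinSequence_canonicalPin hm
    have hlt := fun i j : Fin w.length => hp.lt_iff hm i.2 j.2
    obtain ⟨e, he⟩ := exists_perm_strictMono (f := fun j : Fin w.length => abscissa w[j] j)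
      fun i j h => Fin.ext (abscissa_injective h)
    obtain ⟨e', he'⟩ := exists_perm_strictMono (f := fun j : Fin w.length => ordinate w[j] j)
      fun i j h => Fin.ext (ordinate_injective h)
    have hg' := fun k => (List.getElem?_eq_some_iff.1 (hl k)).1
    have hl' := fun k => (List.getElem?_eq_some_iff.1 (hl k)).2
    have hy : ∀ i j : Fin w.length, e'.symm i < e'.symm j ↔ ordinate w[i] i < ordinate w[j] j := by
      intro i j
      rw [← he'.lt_iff_lt]
      simp
    refine ⟨w.length, e.trans e'.symm, ⟨w, hw, rfl, canonicalPin w, hp, e, fun i j => ?_,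
      fun i j => ?_⟩, OrderEmbedding.ofStrictMono (fun k => e.symm ⟨g k, hg' k⟩) fun i j hij => ?_,
      fun i j => ?_⟩
    · rw [(hlt _ _).1]
      exact he.lt_iff_lt.symm
    · rw [(hlt _ _).2]
      exact hy _ _
    · rw [← he.lt_iff_lt]
      simpa [hl'] using hg hij
    · change _ ↔ e'.symm (e (e.symm ⟨g i, hg' i⟩)) < e'.symm (e (e.symm ⟨g j, hg' j⟩))
      rw [hσ, hy]
      simp [hl']

theorem card_pinClass_le (s : ℕ → ℕ) (n : ℕ) :
    (pinClass s n).ncard ≤ (centredPatterns s n).ncard := by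
  let F : Equiv.Perm (Fin n) → Fin n → Fin n → Prop := fun σ i j => σ i < σ j
  have hF : Function.Injective F := by
    intro σ τ h
    -- The only increasing bijection of `Fin n` is the identity.
    have hmono : StrictMono (τ ∘ σ.symm) := by
      intro i j hij
      have := iff_of_eq (congrFun (congrFun h (σ.symm i)) (σ.symm j))
      simpa [F, hij] using this
    have := (hmono.range_inj strictMono_id).1 (by simp [Set.range_comp])
    ext i
    simpa using congrArg Fin.val (congrFun this (σ i)).symm
  rw [← Set.ncard_image_of_injective _ hF]
  refine (Set.ncard_le_ncard ?_ (Set.toFinite _)).trans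
    (Set.ncard_image_le (f := Prod.fst) (Set.toFinite (centredPatterns s n)))
  rintro _ ⟨σ, hσ, rfl⟩
  obtain ⟨w, hw, g, l, hl, hg, h⟩ := mem_pinClass_iff.1 hσ
  exact ⟨_, ⟨w, hw, g, l, hl, hg, rfl⟩, funext fun i => funext fun j => propext (h i j).symm⟩

/-- The points above the origin are those whose values reach some threshold, which has `n + 1`
possible values. -/
theorem card_centredPatterns_le_mul (s : ℕ → ℕ) (n : ℕ) :
    (centredPatterns s n).ncard ≤ (pinClass s n).ncard * (n + 1) := by
  let F : Equiv.Perm (Fin n) × Fin (n + 1) → (Fin n → Fin n → Prop) × (Fin n → Prop) :=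
    fun q => (fun i j => q.1 i < q.1 j, fun i => (q.2 : ℕ) ≤ q.1 i)
  have hc : (pinClass s n ×ˢ (Set.univ : Set (Fin (n + 1)))).ncard =
      (pinClass s n).ncard * (n + 1) := by
    rw [Set.ncard_prod, Set.ncard_univ, Nat.card_eq_fintype_card, Fintype.card_fin]
  rw [← hc]
  refine (Set.ncard_le_ncard ?_ (Set.toFinite _)).trans
    (Set.ncard_image_le (f := F) (Set.toFinite (pinClass s n ×ˢ (Set.univ : Set (Fin (n + 1))))))
  rintro _ ⟨w, hw, g, l, hl, hg, rfl⟩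
  obtain ⟨e, he⟩ := exists_perm_strictMono (f := fun k => ordinate (l k) (g k)) (by
    intro a b h
    by_contra hab
    have := ordinate_lt_iff_not_lt hl hg hab
    simp only at h
    omega)
  have hσ : ∀ i j, e.symm i < e.symm j ↔ ordinate (l i) (g i) < ordinate (l j) (g j) := by
    intro i j
    rw [← he.lt_iff_lt]
    simp
  have hh : ∃ h : ℕ, h ≤ n ∧ ∀ i, h ≤ e.symm i ↔ 0 < ordinate (l i) (g i) := by
    classical
    have hex : ∃ h : ℕ, ∀ i, h ≤ e.symm i → 0 < ordinate (l i) (g i) :=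
      ⟨n, fun i hi => absurd hi (by omega)⟩
    refine ⟨Nat.find hex, Nat.find_min' hex fun i hi => absurd hi (by omega), fun i =>
      ⟨Nat.find_spec hex i, fun hi => Nat.find_min' hex fun j hj => ?_⟩⟩
    have := (he.le_iff_le (a := e.symm i) (b := e.symm j)).2 hj
    simp only [Function.comp_apply, Equiv.apply_symm_apply] at this
    omega
  obtain ⟨h, hn, hh⟩ := hh
  refine ⟨(e.symm, ⟨h, by omega⟩), ⟨mem_pinClass_iff.2 ⟨w, hw, g, l, hl, hg, hσ⟩, trivial⟩, ?_⟩
  simp only [F, hσ, hh]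

/-! ### Growth rates -/

/-- A supermultiplicative sequence of positive integers with an exponential upper bound, known up
to a linear factor, has a growth rate. -/
theorem exists_tendsto_rpow_of_mul_le {a c : ℕ → ℕ} {K : ℕ}
    (ha : ∀ n, 0 < a n) (hmul : ∀ m n, a m * a n ≤ a (m + n)) (hbd : ∀ n, a n ≤ K ^ n)
    (hca : ∀ n, c n ≤ a n) (hac : ∀ n, a n ≤ c n * (n + 1)) :
    ∃ x : ℝ, Tendsto (fun n : ℕ => (c n : ℝ) ^ (1 / (n : ℝ))) atTop (𝓝 x) := by
  have hc : ∀ n, 0 < c n := fun n => Nat.pos_of_mul_pos_right ((ha n).trans_le (hac n))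
  have ha' : ∀ n, (0 : ℝ) < a n := fun n => by exact_mod_cast ha n
  have hc' : ∀ n, (0 : ℝ) < c n := fun n => by exact_mod_cast hc n
  have hsub : Subadditive fun n => -Real.log (a n) := by
    intro m n
    have := Real.log_le_log (mul_pos (ha' m) (ha' n)) (by exact_mod_cast hmul m n :
      (a m : ℝ) * a n ≤ a (m + n))
    rw [Real.log_mul (ha' m).ne' (ha' n).ne'] at this
    linarith
  have hlim := hsub.tendsto_lim (by
    refine ⟨-Real.log K, ?_⟩
    rintro _ ⟨n, rfl⟩
    -- At `n = 0` the quotient is `0` by convention, and `0 ≤ Real.log K` for natural `K`.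
    rcases Nat.eq_zero_or_pos n with rfl | hn
    · simpa using Real.log_natCast_nonneg K
    have hn' : (0 : ℝ) < n := by exact_mod_cast hn
    have := Real.log_le_log (ha' n) (by exact_mod_cast hbd n : (a n : ℝ) ≤ (K : ℝ) ^ n)
    rw [Real.log_pow] at this
    simp only
    rw [le_div_iff₀ hn']
    linarith)
  have hlog : Tendsto (fun n : ℕ => Real.log ((n : ℝ) + 1) / n) atTop (𝓝 0) := by
    have h := (Real.isLittleO_log_id_atTop.tendsto_div_nhds_zero.comp
      tendsto_natCast_atTop_atTop).const_mul (2 : ℝ)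
    rw [mul_zero] at h
    refine tendsto_of_tendsto_of_tendsto_of_le_of_le' tendsto_const_nhds h
      (Eventually.of_forall fun n => ?_) ((eventually_ge_atTop 2).mono fun n hn => ?_)
    · exact div_nonneg (Real.log_nonneg (by linarith [n.cast_nonneg (α := ℝ)])) n.cast_nonneg
    · have hn : (2 : ℝ) ≤ n := by exact_mod_cast hn
      have := Real.log_le_log (by positivity) (by nlinarith : (n : ℝ) + 1 ≤ (n : ℝ) ^ 2)
      rw [Real.log_pow] at this
      simp only [Function.comp_apply, id, ← mul_div_assoc]
      gcongr
      exact_mod_cast this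
  have hupper := hlim.neg
  have hlower := hupper.sub hlog
  rw [sub_zero] at hlower
  have hmain : Tendsto (fun n : ℕ => Real.log (c n) / n) atTop (𝓝 (-hsub.lim)) := by
    -- The linear factor costs only `Real.log (n + 1) / n`, which tends to `0`.
    refine tendsto_of_tendsto_of_tendsto_of_le_of_le hlower hupper (fun n => ?_) fun n => ?_
    · have := Real.log_le_log (ha' n) (by exact_mod_cast hac n : (a n : ℝ) ≤ c n * (n + 1))
      rw [Real.log_mul (hc' n).ne' (by positivity)] at this
      simp only
      rw [neg_div, neg_neg, ← sub_div]
      gcongr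
      linarith
    · have := Real.log_le_log (hc' n) (by exact_mod_cast hca n : (c n : ℝ) ≤ a n)
      simp only
      rw [neg_div, neg_neg]
      gcongr
  refine ⟨Real.exp (-hsub.lim), ((Real.continuous_exp.tendsto _).comp hmain).congr fun n => ?_⟩
  rw [Function.comp_apply, Real.rpow_def_of_pos (hc' n), mul_one_div]

theorem centredPatterns_nonempty {s : ℕ → ℕ} (hs : ∀ k, 0 < s k) (n : ℕ) :
    (centredPatterns s n).Nonempty := by
  have h0 : [PinLetter.d] ∈ pinLanguage s :=
    mem_pinLanguage_iff.2 ⟨0, [], [.rd, .u, .ru], by simp [alpha, rho]⟩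
  induction n with
  | zero =>
    exact ⟨_, _, h0, Fin.elim0, Fin.elim0, fun k => k.elim0, fun k => k.elim0, rfl⟩
  | succ n ih =>
    have h1 : (centredPatterns s 1).Nonempty :=
      ⟨_, _, h0, fun _ => 0, fun _ => .d, fun _ => by simp, Subsingleton.strictMono _, rfl⟩
    rw [← Set.ncard_pos] at ih h1 ⊢
    exact (Nat.mul_pos ih h1).trans_le (card_centredPatterns_mul_le hs n 1)

end PinClass

theorem mainTheorem9 (s : ℕ → ℕ) (hs : ∀ k, 0 < s k) :
    PinClass.HasProperGrowthRate (PinClass.pinClass s) :=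
  PinClass.exists_tendsto_rpow_of_mul_le (K := 64)
    (fun n => (Set.ncard_pos (Set.toFinite _)).2 (PinClass.centredPatterns_nonempty hs n))
    (PinClass.card_centredPatterns_mul_le hs) (PinClass.card_centredPatterns_le s)
    (PinClass.card_pinClass_le s) (PinClass.card_centredPatterns_le_mul s)
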